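/- Corollary (output filter for $M=2$, $P_1=P_2=1$, softmax). For a square matrix $A$ let $\sigma(A)$ be the row-wise softmax, $\sigma(A)_{ij}=e^{A_{ij}}/\sum_k e^{A_{ik}}$. Let $c\in\mathbb R$ with $c\neq-1$. For a row vector $Z_1\in\mathbb R^{1\times2}$ put $B^1_c(Z_1)=c\,\mathbb 1_2+\sigma(Z_1^\top Z_1)$, and for $H\in\mathbb R^{2\times2}$ with rows $H_1,H_2$ let $$g(H)=\sigma\!\left(B^1_c(H_1)^\top H_2^\top H_2\,B^1_c(H_1)\right)$$ be the link function of the two-layer rank-one softmax attention model with sequence length $2$ and skip connection strength $c$. Let $\omega\in\mathbb R^{2\times2}$, let $V\in\mathbb R^{2\times2}$ be symmetric positive definite, let $\zeta\in\mathbb R^{2\times2}$ have i.i.d. $\mathcal N(0,1)$ entries, $H=\omega+\sqrt V\zeta$ and $Y=g(H)$. The output filter is $$g_{\rm out}(y,\omega,V)=\mathbb E\left[V^{-1}(H-\omega)\,\middle|\,Y=y\right],$$ equivalently $\mathbb E[\zeta\mid Y=y]=\sqrt V\,g_{\rm out}(y,\omega,V)$. Put $$\gamma(x,y)=\frac1{\sqrt{\log\left((x^{-1}-1)(y^{-1}-1)\right)}}\begin{bmatrix}-\log(x^{-1}-1)\\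 \log(y^{-1}-1)\end{bmatrix}.$$ 1. ($\gamma$ inverts the softmax of $zz^\top$.) If $z\in\mathbb R^2$ has $z_1\ne z_2$ and $S=\sigma(zz^\top)$, then for all $w\in\mathbb R^2$: $\sigma(ww^\top)=S$ if and only if $w=\pm\gamma(S_{12},S_{21})$. 2. $\det B^1_c(Z_1)\neq0$ for Lebesgue-almost every $Z_1\in\mathbb R^2$. 3. $Y$ is a measurable function of $\zeta$, and for almost every $y$ with respect to the law of $Y$: $y_{12},y_{21}\in(0,1)$, $(y_{12}^{-1}-1)(y_{21}^{-1}-1)>1$, and for all $l,m\in\{1,2\}$ $$[g_{\rm out}(y,\omega,V)]_{lm}=\frac{\displaystyle\sum_{Z_2}\int_{\mathbb R^2}{\rm d}Z_1\,\frac{e^{-\frac12\sum_{k,k',n=1}^2(Z_{kn}-\omega_{kn})(V^{-1})_{kk'}(Z_{k'n}-\omega_{k'n})}\sum_{l'=1}^2(Z_{l'm}-\omega_{l'm})(V^{-1})_{l'l}}{|\det B^1_c(Z_1)|}}{\displaystyle\sum_{Z_2}\int_{\mathbb R^2}{\rm d}Z_1\,\frac{e^{-\frac12\sum_{k,k',n=1}^2(Z_{kn}-\omega_{kn})(V^{-1})_{kk'}(Z_{k'n}-\omega_{k'n})}}{|\det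 B^1_c(Z_1)|}},$$ where $Z$ is the matrix with rows $Z_1,Z_2$ and the sum over $Z_2$ runs over the solutions (functions of $Z_1$) of the two equations $Z_2\,B^1_c(Z_1)=\pm\gamma(y_{12},y_{21})^\top$. All the integrals converge absolutely and the denominator is positive. -/

import Mathlib

open MeasureTheory ProbabilityTheory Matrix
open scoped MatrixOrder

noncomputable section

instance instMeasurableSpaceMatrixReal {m n : Type*} : MeasurableSpace (Matrix m n ℝ) :=
  inferInstanceAs (MeasurableSpace (m → n → ℝ))

/-- The softmax activation: the softmax function applied to every row of a square matrix. -/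
def softmax {M : ℕ} (A : Matrix (Fin M) (Fin M) ℝ) : Matrix (Fin M) (Fin M) ℝ :=
  Matrix.of fun i j => Real.exp (A i j) / ∑ k, Real.exp (A i k)

/-- The mixing function of the first `l` (non-final) layers with skip connection strength `c`,
`B⁰ = 1` and `Bˡ = Bˡ⁻¹ (c 1 + σ(Bˡ⁻¹ᵀ Z_lᵀ Z_l Bˡ⁻¹))`, as a function of the indices
`Z_1, …, Z_l`, which are `R × M` matrices (`R` is the rank of every layer). -/
def mixing {R M : ℕ} (c : ℝ) :
    (l : ℕ) → (Fin l → Matrix (Fin R) (Fin M) ℝ) → Matrix (Fin M) (Fin M) ℝ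
  | 0, _ => 1
  | l + 1, Z =>
    mixing c l (Fin.init Z) *
      (c • (1 : Matrix (Fin M) (Fin M) ℝ) +
        softmax ((mixing c l (Fin.init Z))ᵀ * (Z (Fin.last l))ᵀ * Z (Fin.last l) *
          mixing c l (Fin.init Z)))

/-- The output of the deep attention model with `l + 1` layers (`l` layers with skip connection
followed by a final softmax attention layer), as a function of the indices. -/
def deepAttention {R M : ℕ} (c : ℝ) (l : ℕ) (Z : Fin (l + 1) → Matrix (Fin R) (Fin M) ℝ) :
    Matrix (Fin M) (Fin M) ℝ :=
  softmax ((mixing c l (Fin.init Z))ᵀ * (Z (Fin.last l))ᵀ * Z (Fin.last l) *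
    mixing c l (Fin.init Z))

/-- The link function of the two-layer rank-one attention model with sequence length two:
row `l` of the argument is the index `Z_l` of layer `l`. -/
def toyLink (c : ℝ) (X : Matrix (Fin 2) (Fin 2) ℝ) : Matrix (Fin 2) (Fin 2) ℝ :=
  deepAttention c 1 fun l => Matrix.replicateRow (Fin 1) (X l)

/-- The law of a `P × M` matrix with i.i.d. standard Gaussian entries. -/
def gaussianMatrix (P M : ℕ) : Measure (Matrix (Fin P) (Fin M) ℝ) :=
  Measure.pi fun _ : Fin P => Measure.pi fun _ : Fin M => gaussianReal 0 1

instance (P M : ℕ) : IsProbabilityMeasure (gaussianMatrix P M) :=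
  inferInstanceAs (IsProbabilityMeasure
    (Measure.pi fun _ : Fin P => Measure.pi fun _ : Fin M => gaussianReal 0 1))

/-- The argument `ω + √V Z` of the link function in the output channel; for standard Gaussian `Z`
its columns are independent and column `m` has law `𝒩(ω_m, V)`. -/
def channelInput {P M : ℕ} (ω : Matrix (Fin P) (Fin M) ℝ) (V : Matrix (Fin P) (Fin P) ℝ)
    (Z : Matrix (Fin P) (Fin M) ℝ) : Matrix (Fin P) (Fin M) ℝ :=
  ω + CFC.sqrt V * Z

/-- The output channel `Y(ω, V) = g(ω + √V Z)`. -/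
def channel {P M K : ℕ} (g : Matrix (Fin P) (Fin M) ℝ → Matrix (Fin K) (Fin K) ℝ)
    (ω : Matrix (Fin P) (Fin M) ℝ) (V : Matrix (Fin P) (Fin P) ℝ)
    (Z : Matrix (Fin P) (Fin M) ℝ) : Matrix (Fin K) (Fin K) ℝ :=
  g (channelInput ω V Z)

/-- `𝔼[X | Y = y]`, the mean of the regular conditional distribution of `X` given `Y = y`. -/
def condMean {α β : Type*} [MeasurableSpace α] [MeasurableSpace β] (μ : Measure α)
    [IsFiniteMeasure μ] (X : α → ℝ) (Y : α → β) (y : β) : ℝ :=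
  ∫ t, t ∂(condDistrib X Y μ y)

/-- `𝔼[Z | Y = y]` for the output channel `Y = g(ω + √V Z)`. -/
def posteriorMean {P M K : ℕ} (g : Matrix (Fin P) (Fin M) ℝ → Matrix (Fin K) (Fin K) ℝ)
    (y : Matrix (Fin K) (Fin K) ℝ) (ω : Matrix (Fin P) (Fin M) ℝ)
    (V : Matrix (Fin P) (Fin P) ℝ) : Matrix (Fin P) (Fin M) ℝ :=
  Matrix.of fun l m =>
    condMean (gaussianMatrix P M) (fun Z => Z l m) (channel g ω V) y

/-- The output filter `g_out(y, ω, V) = 𝔼[V⁻¹ (H - ω) | g(H) = y]`, where `H = ω + √V Z`. -/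
def outputFilter {P M K : ℕ} (g : Matrix (Fin P) (Fin M) ℝ → Matrix (Fin K) (Fin K) ℝ)
    (y : Matrix (Fin K) (Fin K) ℝ) (ω : Matrix (Fin P) (Fin M) ℝ)
    (V : Matrix (Fin P) (Fin P) ℝ) : Matrix (Fin P) (Fin M) ℝ :=
  Matrix.of fun l m =>
    condMean (gaussianMatrix P M) (fun Z => (V⁻¹ * (channelInput ω V Z - ω)) l m)
      (channel g ω V) y

/-- `B_c¹(Z_1) = c 1 + σ(Z_1ᵀ Z_1)` for a first index `Z_1`, a row vector of length two. -/
def mixOne (c : ℝ) (z₁ : Fin 2 → ℝ) : Matrix (Fin 2) (Fin 2) ℝ :=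
  mixing c 1 fun _ => Matrix.replicateRow (Fin 1) z₁

/-- The logarithm under the square root in the definition of `γ`. -/
def gammaLog (x y : ℝ) : ℝ := Real.log ((x⁻¹ - 1) * (y⁻¹ - 1))

/-- The map `γ`. -/
def gammaMap (x y : ℝ) : Fin 2 → ℝ :=
  (1 / √(gammaLog x y)) • ![-Real.log (x⁻¹ - 1), Real.log (y⁻¹ - 1)]

/-- The solution `Z_2` (a row vector) of the equation `Z_2 B_c¹(Z_1) = s γ(y₁₂, y₂₁)`. -/
def secondIndex (c s : ℝ) (y : Matrix (Fin 2) (Fin 2) ℝ) (z₁ : Fin 2 → ℝ) : Fin 2 → ℝ :=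
  (s • gammaMap (y 0 1) (y 1 0)) ᵥ* (mixOne c z₁)⁻¹

theorem secondIndex_unique (c s : ℝ) (y : Matrix (Fin 2) (Fin 2) ℝ) (z₁ z₂ : Fin 2 → ℝ)
    (h : (mixOne c z₁).det ≠ 0) :
    z₂ ᵥ* mixOne c z₁ = s • gammaMap (y 0 1) (y 1 0) ↔ z₂ = secondIndex c s y z₁ := by
  have hu : IsUnit (mixOne c z₁).det := isUnit_iff_ne_zero.mpr h
  unfold secondIndex
  constructor
  · intro h2
    rw [← h2, Matrix.vecMul_vecMul, Matrix.mul_nonsing_inv _ hu, Matrix.vecMul_one]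
  · intro h2
    rw [h2, Matrix.vecMul_vecMul, Matrix.nonsing_inv_mul _ hu, Matrix.vecMul_one]

/-- The Gaussian weight `exp(-∑ (Z_lm - ω_lm) (V⁻¹)_{ll'} (Z_l'm - ω_l'm) / 2)`. -/
def gaussianWeight (ω V Z : Matrix (Fin 2) (Fin 2) ℝ) : ℝ :=
  Real.exp (-∑ l, ∑ l', ∑ m, (Z l m - ω l m) * (Z l' m - ω l' m) * V⁻¹ l l' / 2)

/-- The integrand over `Z_1` in the denominator, with `Z_2` the solution of sign `s`. -/
def denIntegrand (c : ℝ) (y ω V : Matrix (Fin 2) (Fin 2) ℝ) (s : ℝ) (z₁ : Fin 2 → ℝ) : ℝ :=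
  gaussianWeight ω V (Matrix.of ![z₁, secondIndex c s y z₁]) / |(mixOne c z₁).det|

/-- The integrand over `Z_1` in the numerator, with `Z_2` the solution of sign `s`. -/
def numIntegrand (c : ℝ) (y ω V : Matrix (Fin 2) (Fin 2) ℝ) (l m : Fin 2) (s : ℝ)
    (z₁ : Fin 2 → ℝ) : ℝ :=
  gaussianWeight ω V (Matrix.of ![z₁, secondIndex c s y z₁]) *
    (∑ l', ((Matrix.of ![z₁, secondIndex c s y z₁]) l' m - ω l' m) * V⁻¹ l' l) /
      |(mixOne c z₁).det|

/-- The sum over the two solutions `Z_2` of the integrals over `Z_1` in the denominator. -/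
def filterDen (c : ℝ) (y ω V : Matrix (Fin 2) (Fin 2) ℝ) : ℝ :=
  ∑ s ∈ ({1, -1} : Finset ℝ), ∫ z₁ : Fin 2 → ℝ, denIntegrand c y ω V s z₁

/-- The sum over the two solutions `Z_2` of the integrals over `Z_1` in the numerator. -/
def filterNum (c : ℝ) (y ω V : Matrix (Fin 2) (Fin 2) ℝ) (l m : Fin 2) : ℝ :=
  ∑ s ∈ ({1, -1} : Finset ℝ), ∫ z₁ : Fin 2 → ℝ, numIntegrand c y ω V l m s z₁

end

/-!
Write `W = Z₂ B_c¹(Z₁)`, so that `Y = σ(Wᵀ W)`. Since `B_c¹(Z₁)` is almost surely invertible, the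
linear change of variables `Z₂ ↦ W` at fixed `Z₁` gives the pair `(Z₁, W)` an explicit density
with Jacobian factor `1 / |det B_c¹(Z₁)|`. The map `W ↦ Y` is even and `±γ` inverts it almost
everywhere, so `γ(Y) = ±W`, and conditioning on `Y` averages over `Z₁` in the two fibres `W = γ`
and `W = -γ` with weights given by the density. Both fibres enter with the same factor because
Lebesgue measure is invariant under `W ↦ -W`. Almost sure invertibility of `B_c¹(Z₁)` holds because
its determinant is, up to the factor `c + 1`, a non-constant analytic function along almost every
line.
-/

/-! ### Rank-one softmax attention -/

instance instBorelSpaceMatrixReal {m n : Type*} [Countable m] [Countable n] :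
    BorelSpace (Matrix m n ℝ) :=
  inferInstanceAs (BorelSpace (m → n → ℝ))

theorem continuous_softmax {M : ℕ} : Continuous (softmax (M := M)) := by
  refine continuous_matrix fun i j => ?_
  simp only [softmax, Matrix.of_apply]
  refine Continuous.div (by fun_prop) (by fun_prop) fun A => ?_
  exact (Finset.sum_pos (fun _ _ => Real.exp_pos _) ⟨i, Finset.mem_univ i⟩).ne'

theorem sum_softmax_apply {M : ℕ} (A : Matrix (Fin M) (Fin M) ℝ) (i : Fin M) :
    ∑ j, softmax A i j = 1 := by
  simp only [softmax, Matrix.of_apply, ← Finset.sum_div]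
  exact div_self (Finset.sum_pos (fun _ _ => Real.exp_pos _) ⟨i, Finset.mem_univ i⟩).ne'

/-- The output `σ(wᵀ w)` of a rank-one softmax attention layer on the row vector `w`. -/
noncomputable def rankOneAttention {M : ℕ} (w : Fin M → ℝ) : Matrix (Fin M) (Fin M) ℝ :=
  softmax (vecMulVec w w)

theorem continuous_rankOneAttention {M : ℕ} : Continuous (rankOneAttention (M := M)) :=
  continuous_softmax.comp (by fun_prop)

theorem rankOneAttention_neg {M : ℕ} (w : Fin M → ℝ) :
    rankOneAttention (-w) = rankOneAttention w := by
  rw [rankOneAttention, neg_vecMulVec, vecMulVec_neg, neg_neg, rankOneAttention]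

theorem softmax_apply_zero (A : Matrix (Fin 2) (Fin 2) ℝ) (i : Fin 2) :
    softmax A i 0 = Real.sigmoid (A i 0 - A i 1) := by
  simp only [softmax, Matrix.of_apply, Fin.sum_univ_two, Real.sigmoid_def, neg_sub, Real.exp_sub]
  field_simp

theorem softmax_apply_one (A : Matrix (Fin 2) (Fin 2) ℝ) (i : Fin 2) :
    softmax A i 1 = Real.sigmoid (A i 1 - A i 0) := by
  simp only [softmax, Matrix.of_apply, Fin.sum_univ_two, Real.sigmoid_def, neg_sub, Real.exp_sub]
  field_simp
  ring

theorem rankOneAttention_zero_one (w : Fin 2 → ℝ) :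
    rankOneAttention w 0 1 = Real.sigmoid (w 0 * (w 1 - w 0)) := by
  rw [rankOneAttention, softmax_apply_one, vecMulVec_apply, vecMulVec_apply, mul_sub]

theorem rankOneAttention_one_zero (w : Fin 2 → ℝ) :
    rankOneAttention w 1 0 = Real.sigmoid (w 1 * (w 0 - w 1)) := by
  rw [rankOneAttention, softmax_apply_zero, vecMulVec_apply, vecMulVec_apply, mul_sub]

/-- The map `γ` as a function of the output matrix `y`: it recovers the argument of
`rankOneAttention` from its value, up to sign. -/
noncomputable def rankOneAttentionInv (y : Matrix (Fin 2) (Fin 2) ℝ) : Fin 2 → ℝ :=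
  gammaMap (y 0 1) (y 1 0)

theorem measurable_gammaLog :
    Measurable fun y : Matrix (Fin 2) (Fin 2) ℝ => gammaLog (y 0 1) (y 1 0) := by
  have h (i j : Fin 2) : Measurable fun y : Matrix (Fin 2) (Fin 2) ℝ => y i j :=
    (continuous_id.matrix_elem i j).measurable
  exact (((h 0 1).inv.sub_const 1).mul ((h 1 0).inv.sub_const 1)).log

theorem measurable_rankOneAttentionInv : Measurable rankOneAttentionInv := by
  have h (i j : Fin 2) : Measurable fun y : Matrix (Fin 2) (Fin 2) ℝ => y i j :=
    (continuous_id.matrix_elem i j).measurable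
  refine (measurable_gammaLog.sqrt.const_div 1).smul (measurable_pi_iff.mpr ?_)
  exact Fin.forall_fin_two.mpr
    ⟨((h 0 1).inv.sub_const 1).log.neg, ((h 1 0).inv.sub_const 1).log⟩

theorem log_inv_sigmoid_sub_one (x : ℝ) : Real.log ((Real.sigmoid x)⁻¹ - 1) = -x := by
  rw [Real.sigmoid_def, inv_inv, add_sub_cancel_left, Real.log_exp]

theorem gammaLog_sigmoid (x y : ℝ) : gammaLog (Real.sigmoid x) (Real.sigmoid y) = -(x + y) := by
  have inv_sub_one_ne_zero (t : ℝ) : (Real.sigmoid t)⁻¹ - 1 ≠ 0 :=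
    sub_ne_zero.mpr (one_lt_inv₀ (Real.sigmoid_pos t) |>.mpr (Real.sigmoid_lt_one t)).ne'
  rw [gammaLog, Real.log_mul (inv_sub_one_ne_zero x) (inv_sub_one_ne_zero y),
    log_inv_sigmoid_sub_one, log_inv_sigmoid_sub_one, neg_add]

theorem gammaLog_rankOneAttention (w : Fin 2 → ℝ) :
    gammaLog (rankOneAttention w 0 1) (rankOneAttention w 1 0) = (w 1 - w 0) ^ 2 := by
  rw [rankOneAttention_zero_one, rankOneAttention_one_zero, gammaLog_sigmoid]
  ring

theorem rankOneAttentionInv_rankOneAttention (w : Fin 2 → ℝ) :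
    rankOneAttentionInv (rankOneAttention w) = ((w 1 - w 0) / |w 1 - w 0|) • w := by
  have hvec : ![-(-(w 0 * (w 1 - w 0))), -(w 1 * (w 0 - w 1))] = (w 1 - w 0) • w := by
    refine funext (Fin.forall_fin_two.mpr ⟨(neg_neg _).trans (mul_comm _ _), ?_⟩)
    change -(w 1 * (w 0 - w 1)) = (w 1 - w 0) * w 1
    ring
  rw [rankOneAttentionInv, gammaMap, gammaLog_rankOneAttention, Real.sqrt_sq_eq_abs,
    rankOneAttention_zero_one, rankOneAttention_one_zero, log_inv_sigmoid_sub_one,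
    log_inv_sigmoid_sub_one, hvec, smul_smul, one_div_mul_eq_div]

theorem rankOneAttentionInv_rankOneAttention_eq_or_eq_neg {w : Fin 2 → ℝ} (hw : w 0 ≠ w 1) :
    rankOneAttentionInv (rankOneAttention w) = w ∨
      rankOneAttentionInv (rankOneAttention w) = -w := by
  rw [rankOneAttentionInv_rankOneAttention]
  rcases lt_or_gt_of_ne hw with h | h
  · left
    rw [abs_of_pos (sub_pos.mpr h), div_self (sub_pos.mpr h).ne', one_smul]
  · right
    rw [abs_of_neg (sub_neg.mpr h), div_neg, div_self (sub_neg.mpr h).ne, neg_one_smul]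

theorem rankOneAttention_eq_iff {z : Fin 2 → ℝ} (hz : z 0 ≠ z 1) (w : Fin 2 → ℝ) :
    rankOneAttention w = rankOneAttention z ↔
      w = rankOneAttentionInv (rankOneAttention z) ∨
        w = -rankOneAttentionInv (rankOneAttention z) := by
  constructor
  · intro h
    have hsq : (w 1 - w 0) ^ 2 = (z 1 - z 0) ^ 2 := by
      rw [← gammaLog_rankOneAttention, h, gammaLog_rankOneAttention]
    have hw : w 0 ≠ w 1 := by
      intro hw
      rw [hw, sub_self, zero_pow two_ne_zero, eq_comm, sq_eq_zero_iff, sub_eq_zero] at hsq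
      exact hz hsq.symm
    rw [← h]
    rcases rankOneAttentionInv_rankOneAttention_eq_or_eq_neg hw with h' | h' <;> simp [h']
  · rcases rankOneAttentionInv_rankOneAttention_eq_or_eq_neg hz with h | h <;> rw [h] <;>
      rintro (rfl | rfl) <;> simp only [neg_neg, rankOneAttention_neg]

theorem continuous_mixing {R M : ℕ} (c : ℝ) (l : ℕ) :
    Continuous (mixing (R := R) (M := M) c l) := by
  induction l with
  | zero => exact continuous_const
  | succ l ih =>
    have hB : Continuous fun Z : Fin (l + 1) → Matrix (Fin R) (Fin M) ℝ =>
        mixing c l (Fin.init Z) := ih.comp continuous_id.finInit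
    exact hB.mul (continuous_const.add (continuous_softmax.comp (by fun_prop)))

theorem continuous_deepAttention {R M : ℕ} (c : ℝ) (l : ℕ) :
    Continuous (deepAttention (R := R) (M := M) c l) := by
  have hB : Continuous fun Z : Fin (l + 1) → Matrix (Fin R) (Fin M) ℝ =>
      mixing c l (Fin.init Z) := (continuous_mixing c l).comp continuous_id.finInit
  exact continuous_softmax.comp (by fun_prop)

theorem continuous_toyLink (c : ℝ) : Continuous (toyLink c) :=
  (continuous_deepAttention c 1).comp <| continuous_pi fun l =>
    continuous_matrix fun _ j => continuous_id.matrix_elem l j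

theorem continuous_mixOne (c : ℝ) : Continuous (mixOne c) :=
  (continuous_mixing c 1).comp <| continuous_pi fun _ =>
    continuous_matrix fun _ j => continuous_apply j

theorem transpose_replicateRow_mul_replicateRow {ι : Type*} (v : ι → ℝ) :
    (replicateRow (Fin 1) v)ᵀ * replicateRow (Fin 1) v = vecMulVec v v := by
  ext i j
  simp [Matrix.mul_apply, vecMulVec_apply]

theorem mixOne_eq (c : ℝ) (z : Fin 2 → ℝ) :
    mixOne c z = c • (1 : Matrix (Fin 2) (Fin 2) ℝ) + rankOneAttention z := by
  simp only [mixOne, mixing, transpose_one, Matrix.one_mul, Matrix.mul_one,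
    transpose_replicateRow_mul_replicateRow, rankOneAttention]

theorem toyLink_eq (c : ℝ) (X : Matrix (Fin 2) (Fin 2) ℝ) :
    toyLink c X = rankOneAttention (X 1 ᵥ* mixOne c (X 0)) := by
  have hmix : mixing c 1 (Fin.init fun l : Fin 2 => replicateRow (Fin 1) (X l)) =
      mixOne c (X 0) :=
    congrArg (mixing c 1) (funext fun i => by rw [Subsingleton.elim i 0]; rfl)
  rw [toyLink, deepAttention, hmix, show Fin.last 1 = 1 from rfl, Matrix.mul_assoc,
    ← transpose_mul, ← replicateRow_vecMul, transpose_replicateRow_mul_replicateRow,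
    rankOneAttention]

theorem det_mixOne (c : ℝ) (z : Fin 2 → ℝ) :
    (mixOne c z).det = (c + 1) * (c + 1 - Real.sigmoid (z 0 * (z 1 - z 0)) -
      Real.sigmoid (z 1 * (z 0 - z 1))) := by
  have row_sum (i : Fin 2) : rankOneAttention z i 0 + rankOneAttention z i 1 = 1 :=
    (Fin.sum_univ_two _).symm.trans (sum_softmax_apply (vecMulVec z z) i)
  rw [← rankOneAttention_zero_one, ← rankOneAttention_one_zero, mixOne_eq, det_fin_two]
  simp only [Matrix.add_apply, Matrix.smul_apply, one_apply_eq, ne_eq, zero_ne_one, one_ne_zero,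
    not_false_eq_true, one_apply_ne, smul_eq_mul, mul_one, mul_zero, zero_add,
    eq_sub_of_add_eq (row_sum 0), eq_sub_of_add_eq' (row_sum 1)]
  ring

theorem ae_apply_zero_ne_apply_one : ∀ᵐ w : Fin 2 → ℝ, w 0 ≠ w 1 := by
  have hprod : ∀ᵐ p : ℝ × ℝ, p.1 ≠ p.2 :=
    (Measure.ae_prod_iff_ae_ae (measurableSet_eq_fun measurable_fst measurable_snd).compl).mpr
      (.of_forall fun x => (Measure.ae_ne volume x).mono fun _ => Ne.symm)
  exact (volume_preserving_finTwoArrow ℝ).quasiMeasurePreserving.ae hprod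

theorem ae_rankOneAttentionInv_rankOneAttention :
    ∀ᵐ w : Fin 2 → ℝ, rankOneAttentionInv (rankOneAttention w) = w ∨
      rankOneAttentionInv (rankOneAttention w) = -w :=
  ae_apply_zero_ne_apply_one.mono fun _ => rankOneAttentionInv_rankOneAttention_eq_or_eq_neg

theorem ae_ne_zero_of_analyticOnNhd {f : ℝ → ℝ} (hf : AnalyticOnNhd ℝ f Set.univ) {x₀ : ℝ}
    (hx₀ : f x₀ ≠ 0) : ∀ᵐ x, f x ≠ 0 := by
  have hcod := ae_restrict_le_codiscreteWithin (μ := volume) MeasurableSet.univ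
    (hf.preimage_zero_mem_codiscrete hx₀)
  rw [Measure.restrict_univ] at hcod
  exact hcod

theorem ae_det_mixOne_ne_zero_of_ne_zero {c : ℝ} (hc : c ≠ -1) {y : ℝ} (hy : y ≠ 0) :
    ∀ᵐ x : ℝ, (mixOne c ![x, y]).det ≠ 0 := by
  have hc' : c + 1 ≠ 0 := fun h => hc (eq_neg_of_add_eq_zero_left h)
  let f : ℝ → ℝ := fun x => c + 1 - Real.sigmoid (x * (y - x)) - Real.sigmoid (y * (x - y))
  have hf : AnalyticOnNhd ℝ f Set.univ := fun x _ =>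
    (analyticAt_const.sub (AnalyticAt.sigmoid' (by fun_prop))).sub
      (AnalyticAt.sigmoid' (by fun_prop))
  have f_zero_ne : f 0 ≠ f y := by
    intro h
    have hsigmoid : Real.sigmoid (-(y * y)) = Real.sigmoid 0 := by
      simpa [f] using h
    exact hy (mul_self_eq_zero.mp (neg_eq_zero.mp (Real.sigmoid_injective hsigmoid)))
  obtain ⟨x₀, hx₀⟩ : ∃ x₀, f x₀ ≠ 0 := by
    by_contra! h
    exact f_zero_ne ((h 0).trans (h y).symm)
  filter_upwards [ae_ne_zero_of_analyticOnNhd hf hx₀] with x hx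
  rw [det_mixOne]
  exact mul_ne_zero hc' hx

theorem ae_det_mixOne_ne_zero {c : ℝ} (hc : c ≠ -1) :
    ∀ᵐ z : Fin 2 → ℝ, (mixOne c z).det ≠ 0 := by
  have hmeas : MeasurableSet {p : ℝ × ℝ | (mixOne c ![p.2, p.1]).det ≠ 0} := by
    have hcont : Continuous fun p : ℝ × ℝ => (mixOne c ![p.2, p.1]).det :=
      ((continuous_mixOne c).comp (by fun_prop)).matrix_det
    exact (isOpen_ne.preimage hcont).measurableSet
  have hprod : ∀ᵐ p : ℝ × ℝ, (mixOne c ![p.2, p.1]).det ≠ 0 :=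
    (Measure.ae_prod_iff_ae_ae hmeas).mpr
      ((Measure.ae_ne volume 0).mono fun y hy => ae_det_mixOne_ne_zero_of_ne_zero hc hy)
  have hmp : MeasurePreserving fun z : Fin 2 → ℝ => (z 1, z 0) :=
    Measure.measurePreserving_swap.comp (volume_preserving_finTwoArrow ℝ)
  filter_upwards [hmp.quasiMeasurePreserving.ae hprod] with z hz
  rwa [show z = ![z 0, z 1] from (FinVec.etaExpand_eq z).symm]

/-! ### Densities up to a constant -/

theorem map_withDensity_comp {α β : Type*} [MeasurableSpace α] [MeasurableSpace β]
    (μ : Measure α) {f : α → β} (hf : Measurable f) {g : β → ENNReal} (hg : Measurable g) :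
    (μ.withDensity (g ∘ f)).map f = (μ.map f).withDensity g := by
  ext s hs
  rw [Measure.map_apply hf hs, withDensity_apply _ (hf hs), withDensity_apply _ hs,
    setLIntegral_map hs hg hf]
  rfl

theorem pi_withDensity_ofReal {ι : Type*} [Fintype ι] {α : ι → Type*}
    [∀ i, MeasurableSpace (α i)] (ν : ∀ i, Measure (α i)) [∀ i, SigmaFinite (ν i)]
    {f : ∀ i, α i → ℝ} (hf : ∀ i, Integrable (f i) (ν i)) (hf0 : ∀ i x, 0 ≤ f i x) :
    Measure.pi (fun i => (ν i).withDensity fun x => ENNReal.ofReal (f i x)) =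
      (Measure.pi ν).withDensity fun x => ENNReal.ofReal (∏ i, f i (x i)) := by
  have (i : ι) : IsFiniteMeasure ((ν i).withDensity fun x => ENNReal.ofReal (f i x)) :=
    isFiniteMeasure_withDensity_ofReal (hf i).2
  refine Measure.pi_eq fun s hs => ?_
  have hint : Integrable (fun x : ∀ i, α i => ∏ i, f i (x i))
      (Measure.pi fun i => (ν i).restrict (s i)) :=
    Integrable.fintype_prod_dep fun i => (hf i).restrict
  rw [withDensity_apply _ (.univ_pi hs), Measure.restrict_pi_pi,
    ← ofReal_integral_eq_lintegral_ofReal hint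
      (.of_forall fun x => Finset.prod_nonneg fun i _ => hf0 i (x i)),
    integral_fintype_prod_eq_prod,
    ENNReal.ofReal_prod_of_nonneg fun i _ => integral_nonneg (hf0 i)]
  refine Finset.prod_congr rfl fun i _ => ?_
  rw [withDensity_apply _ (hs i), ofReal_integral_eq_lintegral_ofReal (hf i).restrict
    (.of_forall (hf0 i))]

/-- `μ` has a density proportional to `ρ` with respect to `ν`. The constant of proportionality is
left out because it cancels in conditional means. Negative values of `ρ` are read as `0`. -/
def HasDensityPropTo {α : Type*} [MeasurableSpace α] (μ ν : Measure α) (ρ : α → ℝ) : Prop :=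
  ∃ K : ENNReal, K ≠ 0 ∧ K ≠ ⊤ ∧ μ = K • ν.withDensity fun a => ENNReal.ofReal (ρ a)

namespace HasDensityPropTo

variable {α β : Type*} [MeasurableSpace α] [MeasurableSpace β] {μ ν : Measure α} {ρ : α → ℝ}

theorem of_const_mul {k : ℝ} (hk : 0 < k) (hρ : Measurable ρ)
    (h : μ = ν.withDensity fun a => ENNReal.ofReal (k * ρ a)) : HasDensityPropTo μ ν ρ := by
  refine ⟨ENNReal.ofReal k, (ENNReal.ofReal_pos.mpr hk).ne', ENNReal.ofReal_ne_top, ?_⟩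
  rw [h, ← withDensity_smul _ hρ.ennreal_ofReal]
  simp only [ENNReal.ofReal_mul hk.le]
  rfl

theorem absolutelyContinuous (h : HasDensityPropTo μ ν ρ) : μ ≪ ν := by
  obtain ⟨K, -, -, rfl⟩ := h
  exact (withDensity_absolutelyContinuous ν _).smul_left K

theorem integrable_iff (h : HasDensityPropTo μ ν ρ) (hρ : Measurable ρ) (hρ0 : ∀ a, 0 ≤ ρ a)
    {f : α → ℝ} : Integrable f μ ↔ Integrable (fun a => ρ a * f a) ν := by
  obtain ⟨K, hK0, hK, rfl⟩ := h
  rw [integrable_smul_measure hK0 hK, integrable_withDensity_iff_integrable_smul'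
    hρ.ennreal_ofReal (.of_forall fun _ => ENNReal.ofReal_lt_top)]
  simp only [ENNReal.toReal_ofReal (hρ0 _), smul_eq_mul]

theorem setIntegral_eq_iff (h : HasDensityPropTo μ ν ρ) (hρ : Measurable ρ)
    (hρ0 : ∀ a, 0 ≤ ρ a) {f g : α → ℝ} {A : Set α} (hA : MeasurableSet A) :
    ∫ a in A, f a ∂μ = ∫ a in A, g a ∂μ ↔
      ∫ a in A, ρ a * f a ∂ν = ∫ a in A, ρ a * g a ∂ν := by
  obtain ⟨K, hK0, hK, rfl⟩ := h
  have setIntegral_smul_withDensity (f : α → ℝ) :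
      ∫ a in A, f a ∂(K • ν.withDensity fun a => ENNReal.ofReal (ρ a)) =
        K.toReal * ∫ a in A, ρ a * f a ∂ν := by
    rw [Measure.restrict_smul, integral_smul_measure,
      setIntegral_withDensity_eq_setIntegral_toReal_smul hρ.ennreal_ofReal
        (.of_forall fun _ => ENNReal.ofReal_lt_top) _ hA]
    simp only [ENNReal.toReal_ofReal (hρ0 _), smul_eq_mul]
  rw [setIntegral_smul_withDensity, setIntegral_smul_withDensity,
    mul_right_inj' (ENNReal.toReal_ne_zero.mpr ⟨hK0, hK⟩)]

theorem map {ν' : Measure β} {f : α → β} {g J : β → ℝ} (h : HasDensityPropTo μ ν ρ)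
    (hf : Measurable f) (hJ : Measurable J) (hJ0 : ∀ b, 0 ≤ J b)
    (hν : HasDensityPropTo (ν.map f) ν' J) (hg : Measurable g) (hρ : ρ =ᵐ[ν] g ∘ f) :
    HasDensityPropTo (μ.map f) ν' fun b => J b * g b := by
  obtain ⟨K, hK0, hK, rfl⟩ := h
  obtain ⟨K', hK0', hK', hν⟩ := hν
  refine ⟨K * K', mul_ne_zero hK0 hK0', ENNReal.mul_ne_top hK hK', ?_⟩
  have hρg : (fun a => ENNReal.ofReal (ρ a)) =ᵐ[ν] (fun b => ENNReal.ofReal (g b)) ∘ f :=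
    hρ.mono fun a ha => congrArg ENNReal.ofReal ha
  rw [withDensity_congr_ae hρg, Measure.map_smul, map_withDensity_comp ν hf hg.ennreal_ofReal,
    hν, withDensity_smul_measure, smul_smul,
    ← withDensity_mul _ hJ.ennreal_ofReal hg.ennreal_ofReal]
  simp only [ENNReal.ofReal_mul (hJ0 _)]
  rfl

theorem of_isAddHaarMeasure {G : Type*} [TopologicalSpace G] [AddGroup G]
    [IsTopologicalAddGroup G] [MeasurableSpace G] [BorelSpace G] [LocallyCompactSpace G]
    [SecondCountableTopology G] (μ ν : Measure G) [μ.IsAddHaarMeasure] [ν.IsAddHaarMeasure] :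
    HasDensityPropTo μ ν 1 := by
  refine ⟨μ.addHaarScalarFactor ν, ENNReal.coe_ne_zero.mpr
    (Measure.addHaarScalarFactor_pos_of_isAddHaarMeasure μ ν).ne', ENNReal.coe_ne_top, ?_⟩
  simp only [Pi.one_apply, ENNReal.ofReal_one, withDensity_const, one_smul]
  exact Measure.isAddLeftInvariant_eq_smul μ ν

end HasDensityPropTo

noncomputable instance instMeasureSpaceMatrixReal {m n : Type*} [Fintype m] [Fintype n] :
    MeasureSpace (Matrix m n ℝ) where
  volume := (volume : Measure (m → n → ℝ))

instance instIsAddHaarMeasureMatrixReal {m n : Type*} [Fintype m] [Fintype n] :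
    (volume : Measure (Matrix m n ℝ)).IsAddHaarMeasure :=
  Measure.pi.isAddHaarMeasure fun _ : m => (volume : Measure (n → ℝ))

theorem hasDensityPropTo_gaussianMatrix (P M : ℕ) :
    HasDensityPropTo (gaussianMatrix P M) volume fun ζ => Real.exp (-(ζᵀ * ζ).trace / 2) := by
  have row : Measure.pi (fun _ : Fin M => gaussianReal 0 1) =
      volume.withDensity fun v => ENNReal.ofReal (∏ j, gaussianPDFReal 0 1 (v j)) := by
    rw [gaussianReal_of_var_ne_zero 0 one_ne_zero]
    exact pi_withDensity_ofReal _ (fun _ => integrable_gaussianPDFReal 0 1)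
      fun _ => gaussianPDFReal_nonneg 0 1
  have density : gaussianMatrix P M =
      volume.withDensity fun ζ => ENNReal.ofReal (∏ i, ∏ j, gaussianPDFReal 0 1 (ζ i j)) := by
    rw [gaussianMatrix, row]
    exact pi_withDensity_ofReal _
      (fun _ => Integrable.fintype_prod fun _ => integrable_gaussianPDFReal 0 1)
      fun _ v => Finset.prod_nonneg fun j _ => gaussianPDFReal_nonneg 0 1 (v j)
  refine .of_const_mul (k := ((√(2 * Real.pi))⁻¹ ^ M) ^ P) (by positivity) ?_ ?_
  · exact Continuous.measurable (by fun_prop)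
  rw [density]
  congr! 3
  simp only [gaussianPDFReal, NNReal.coe_one, mul_one, sub_zero, Finset.prod_mul_distrib,
    Finset.prod_const, Finset.card_univ, Fintype.card_fin, ← Real.exp_sum, ← Finset.sum_div,
    Finset.sum_neg_distrib, Matrix.trace, Matrix.diag, Matrix.mul_apply, transpose_apply, ← sq]
  rw [Finset.sum_comm]

section

variable {P M : ℕ} (ω : Matrix (Fin P) (Fin M) ℝ) {V : Matrix (Fin P) (Fin P) ℝ}

theorem continuous_channelInput (V : Matrix (Fin P) (Fin P) ℝ) :
    Continuous (channelInput ω V) := by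
  unfold channelInput
  fun_prop

theorem sqrt_mul_sqrt_of_posDef (hV : V.PosDef) : CFC.sqrt V * CFC.sqrt V = V :=
  CFC.sqrt_mul_sqrt_self V (nonneg_iff_posSemidef.mpr hV.posSemidef)

theorem isUnit_det_sqrt (hV : V.PosDef) : IsUnit (CFC.sqrt V).det := by
  refine isUnit_of_mul_isUnit_left (y := (CFC.sqrt V).det) ?_
  rw [← det_mul, sqrt_mul_sqrt_of_posDef hV]
  exact isUnit_iff_ne_zero.mpr hV.det_pos.ne'

theorem transpose_sqrt (V : Matrix (Fin P) (Fin P) ℝ) : (CFC.sqrt V)ᵀ = CFC.sqrt V :=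
  (IsSelfAdjoint.of_nonneg (CFC.sqrt_nonneg V)).star_eq

theorem hasDensityPropTo_map_channelInput_volume (hV : V.PosDef) :
    HasDensityPropTo ((volume : Measure (Matrix (Fin P) (Fin M) ℝ)).map (channelInput ω V))
      volume 1 := by
  let e : Matrix (Fin P) (Fin M) ℝ ≃L[ℝ] Matrix (Fin P) (Fin M) ℝ :=
    (LinearEquiv.ofLinearMap (mulLeftLinearMap (Fin M) ℝ (CFC.sqrt V))
      (mulLeftLinearMap (Fin M) ℝ (CFC.sqrt V)⁻¹)
      (by rw [← mulLeftLinearMap_mul, mul_nonsing_inv _ (isUnit_det_sqrt hV),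
        mulLeftLinearMap_one])
      (by rw [← mulLeftLinearMap_mul, nonsing_inv_mul _ (isUnit_det_sqrt hV),
        mulLeftLinearMap_one])).toContinuousLinearEquiv
  have hmap : volume.map (channelInput ω V) = volume.map e := by
    rw [← map_add_left_eq_self (volume.map e) ω,
      Measure.map_map (measurable_const_add ω) e.continuous.measurable]
    rfl
  have : LocallyCompactSpace (Matrix (Fin P) (Fin M) ℝ) :=
    inferInstanceAs (LocallyCompactSpace (Fin P → Fin M → ℝ))
  have : SecondCountableTopology (Matrix (Fin P) (Fin M) ℝ) :=
    inferInstanceAs (SecondCountableTopology (Fin P → Fin M → ℝ))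
  rw [hmap]
  exact .of_isAddHaarMeasure _ _

theorem inv_mul_channelInput_sub (hV : V.PosDef) (ζ : Matrix (Fin P) (Fin M) ℝ) :
    V⁻¹ * (channelInput ω V ζ - ω) = (CFC.sqrt V)⁻¹ * ζ := by
  rw [channelInput, add_sub_cancel_left]
  nth_rw 1 [← sqrt_mul_sqrt_of_posDef hV]
  rw [Matrix.mul_inv_rev, Matrix.mul_assoc, nonsing_inv_mul_cancel_left _ _ (isUnit_det_sqrt hV)]

theorem hasDensityPropTo_map_channelInput_gaussianMatrix (hV : V.PosDef) :
    HasDensityPropTo ((gaussianMatrix P M).map (channelInput ω V)) volume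
      fun X => Real.exp (-((X - ω)ᵀ * (V⁻¹ * (X - ω))).trace / 2) := by
  have hmap := (hasDensityPropTo_gaussianMatrix P M).map
    (continuous_channelInput ω V).measurable measurable_one (fun _ => zero_le_one)
    (hasDensityPropTo_map_channelInput_volume ω hV)
    (g := fun X => Real.exp (-((X - ω)ᵀ * (V⁻¹ * (X - ω))).trace / 2))
    (Continuous.measurable (by fun_prop)) (.of_forall fun ζ => ?_)
  · simpa only [Pi.one_apply, one_mul] using hmap
  · rw [Function.comp_apply, inv_mul_channelInput_sub ω hV, channelInput, add_sub_cancel_left,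
      transpose_mul, transpose_sqrt, Matrix.mul_assoc,
      mul_nonsing_inv_cancel_left _ _ (isUnit_det_sqrt hV)]

end

theorem gaussianWeight_eq (ω V X : Matrix (Fin 2) (Fin 2) ℝ) :
    gaussianWeight ω V X = Real.exp (-((X - ω)ᵀ * (V⁻¹ * (X - ω))).trace / 2) := by
  simp only [gaussianWeight, Matrix.trace, Matrix.diag, Matrix.mul_apply, Fin.sum_univ_two,
    transpose_apply, Matrix.sub_apply]
  congr 1
  ring

/-! ### The law of the pair `(Z₁, Z₂ B_c¹(Z₁))` -/

section

variable {n : Type*} [Fintype n] [DecidableEq n]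

theorem map_vecMul_volume {B : Matrix n n ℝ} (hB : B.det ≠ 0) :
    (volume : Measure (n → ℝ)).map (· ᵥ* B) = ENNReal.ofReal |B.det|⁻¹ • volume := by
  rw [← abs_inv, ← det_transpose,
    ← Real.map_matrix_volume_pi_eq_smul_volume_pi (by rwa [det_transpose])]
  exact congrArg volume.map (funext fun w => (mulVec_transpose B w).symm)

theorem map_vecMul_prod {α : Type*} [MeasurableSpace α] {ν : Measure α}
    {B : α → Matrix n n ℝ} (hB : Measurable B) (hdet : ∀ᵐ z ∂ν, (B z).det ≠ 0) :
    (ν.prod (volume : Measure (n → ℝ))).map (fun p => (p.1, p.2 ᵥ* B p.1)) =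
      (ν.prod volume).withDensity fun p => ENNReal.ofReal |(B p.1).det|⁻¹ := by
  have hvecMul : Measurable fun p : α × (n → ℝ) => p.2 ᵥ* B p.1 :=
    (continuous_snd.matrix_vecMul continuous_fst).measurable.comp
      ((hB.comp measurable_fst).prodMk measurable_snd)
  have hdens : Measurable fun z => ENNReal.ofReal |(B z).det|⁻¹ :=
    ((continuous_id.matrix_det.measurable.comp hB).abs.inv).ennreal_ofReal
  rw [← prod_withDensity_left hdens]
  ext s hs
  rw [Measure.map_apply (measurable_fst.prodMk hvecMul) hs,
    Measure.prod_apply (measurable_fst.prodMk hvecMul hs), Measure.prod_apply hs,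
    lintegral_withDensity_eq_lintegral_mul _ hdens (measurable_measure_prodMk_left hs)]
  refine lintegral_congr_ae (hdet.mono fun z hz => ?_)
  have hfiber := congrArg (· (Prod.mk z ⁻¹' s)) (map_vecMul_volume hz)
  rwa [Measure.map_apply (by fun_prop) (measurable_prodMk_left hs)] at hfiber

end

/-- The pair `(Z₁, Z₂ B_c¹(Z₁))`; the output is a function of its second component. -/
noncomputable def mixIndices (c : ℝ) (X : Matrix (Fin 2) (Fin 2) ℝ) : (Fin 2 → ℝ) × (Fin 2 → ℝ) :=
  (X 0, X 1 ᵥ* mixOne c (X 0))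

/-- The inverse of `mixIndices`, valid where `B_c¹(Z₁)` is invertible: the index matrix with rows
`Z₁` and `w B_c¹(Z₁)⁻¹`. -/
noncomputable def unmixIndices (c : ℝ) (p : (Fin 2 → ℝ) × (Fin 2 → ℝ)) :
    Matrix (Fin 2) (Fin 2) ℝ :=
  Matrix.of ![p.1, p.2 ᵥ* (mixOne c p.1)⁻¹]

theorem unmixIndices_mixIndices {c : ℝ} {X : Matrix (Fin 2) (Fin 2) ℝ}
    (hX : (mixOne c (X 0)).det ≠ 0) : unmixIndices c (mixIndices c X) = X := by
  rw [unmixIndices, mixIndices, vecMul_vecMul, mul_nonsing_inv _ (isUnit_iff_ne_zero.mpr hX),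
    vecMul_one]
  exact FinVec.etaExpand_eq (α := Fin 2 → ℝ) X

theorem ae_unmixIndices_mixIndices {c : ℝ} (hc : c ≠ -1) :
    ∀ᵐ X : Matrix (Fin 2) (Fin 2) ℝ, unmixIndices c (mixIndices c X) = X :=
  ((Measure.quasiMeasurePreserving_eval (fun _ : Fin 2 => (volume : Measure (Fin 2 → ℝ)))
    0).ae (ae_det_mixOne_ne_zero hc)).mono fun _ => unmixIndices_mixIndices

theorem continuous_mixIndices (c : ℝ) : Continuous (mixIndices c) := by
  have row (i : Fin 2) : Continuous fun X : Matrix (Fin 2) (Fin 2) ℝ => X i := continuous_apply i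
  exact (row 0).prodMk ((row 1).matrix_vecMul ((continuous_mixOne c).comp (row 0)))

theorem measurable_unmixIndices (c : ℝ) : Measurable (unmixIndices c) := by
  have hinv : Measurable fun z : Fin 2 → ℝ => (mixOne c z)⁻¹ := by
    simp only [Matrix.inv_def, Ring.inverse_eq_inv']
    exact (continuous_mixOne c).matrix_det.measurable.inv.smul
      (continuous_mixOne c).matrix_adjugate.measurable
  refine measurable_pi_iff.mpr (Fin.forall_fin_two.mpr ⟨measurable_fst, ?_⟩)
  exact (continuous_snd.matrix_vecMul continuous_fst).measurable.comp
    ((hinv.comp measurable_fst).prodMk measurable_snd)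

theorem hasDensityPropTo_map_mixIndices_volume {c : ℝ} (hc : c ≠ -1) :
    HasDensityPropTo ((volume : Measure (Matrix (Fin 2) (Fin 2) ℝ)).map (mixIndices c))
      volume fun p => |(mixOne c p.1).det|⁻¹ := by
  have hrows : MeasurePreserving fun X : Matrix (Fin 2) (Fin 2) ℝ => (X 0, X 1) :=
    volume_preserving_finTwoArrow (Fin 2 → ℝ)
  have hmix : Continuous fun p : (Fin 2 → ℝ) × (Fin 2 → ℝ) => (p.1, p.2 ᵥ* mixOne c p.1) :=
    continuous_fst.prodMk
      (continuous_snd.matrix_vecMul ((continuous_mixOne c).comp continuous_fst))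
  have hmap : volume.map (mixIndices c) = (volume.map fun X : Matrix (Fin 2) (Fin 2) ℝ =>
      (X 0, X 1)).map fun p => (p.1, p.2 ᵥ* mixOne c p.1) :=
    (Measure.map_map hmix.measurable hrows.measurable).symm
  refine ⟨1, one_ne_zero, ENNReal.one_ne_top, ?_⟩
  rw [hmap, hrows.map_eq, one_smul]
  exact map_vecMul_prod (continuous_mixOne c).measurable (ae_det_mixOne_ne_zero hc)

/-- The density of the law of `(Z₁, Z₂ B_c¹(Z₁))`, up to a constant. -/
noncomputable def mixedDensity (c : ℝ) (ω V : Matrix (Fin 2) (Fin 2) ℝ)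
    (p : (Fin 2 → ℝ) × (Fin 2 → ℝ)) : ℝ :=
  gaussianWeight ω V (unmixIndices c p) / |(mixOne c p.1).det|

section

variable (c : ℝ) (ω V : Matrix (Fin 2) (Fin 2) ℝ)

theorem measurable_gaussianWeight : Measurable (gaussianWeight ω V) := by
  simp only [funext (gaussianWeight_eq ω V)]
  exact Continuous.measurable (by fun_prop)

theorem measurable_mixedDensity : Measurable (mixedDensity c ω V) :=
  ((measurable_gaussianWeight ω V).comp (measurable_unmixIndices c)).div
    ((continuous_mixOne c).matrix_det.measurable.comp measurable_fst).abs

theorem mixedDensity_nonneg (p : (Fin 2 → ℝ) × (Fin 2 → ℝ)) : 0 ≤ mixedDensity c ω V p :=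
  div_nonneg (Real.exp_pos _).le (abs_nonneg _)

end

theorem hasDensityPropTo_map_mixIndices_channelInput {c : ℝ} (hc : c ≠ -1)
    (ω : Matrix (Fin 2) (Fin 2) ℝ) {V : Matrix (Fin 2) (Fin 2) ℝ} (hV : V.PosDef) :
    HasDensityPropTo ((gaussianMatrix 2 2).map (mixIndices c ∘ channelInput ω V)) volume
      (mixedDensity c ω V) := by
  have hmap := (hasDensityPropTo_map_channelInput_gaussianMatrix (M := 2) ω hV).map
    (continuous_mixIndices c).measurable
    ((continuous_mixOne c).matrix_det.measurable.comp measurable_fst).abs.inv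
    (fun _ => inv_nonneg.mpr (abs_nonneg _)) (hasDensityPropTo_map_mixIndices_volume hc)
    ((measurable_gaussianWeight ω V).comp (measurable_unmixIndices c))
    ((ae_unmixIndices_mixIndices hc).mono fun X hX => by
      rw [Function.comp_apply, Function.comp_apply, hX, gaussianWeight_eq])
  rw [Measure.map_map (continuous_mixIndices c).measurable
    (continuous_channelInput ω V).measurable] at hmap
  exact (funext fun p => inv_mul_eq_div _ _ : _ = mixedDensity c ω V) ▸ hmap

/-! ### Conditional means -/

section

variable {α β : Type*} [MeasurableSpace α] [MeasurableSpace β] (μ : Measure α)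
  [IsFiniteMeasure μ]

theorem stronglyMeasurable_condMean (X : α → ℝ) (Y : α → β) :
    StronglyMeasurable (condMean μ X Y) :=
  StronglyMeasurable.integral_condDistrib (f := fun p : β × ℝ => p.2)
    measurable_snd.stronglyMeasurable

theorem condMean_congr {X X' : α → ℝ} (h : X =ᵐ[μ] X') (Y : α → β) :
    condMean μ X Y = condMean μ X' Y := by
  ext y
  rw [condMean, condMean, condDistrib_congr_left h]

theorem condMean_map {γ : Type*} [MeasurableSpace γ] {T : α → γ} (hT : Measurable T)
    {X : γ → ℝ} (hX : Measurable X) {Y : γ → β} (hY : Measurable Y) :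
    condMean (μ.map T) X Y = condMean μ (X ∘ T) (Y ∘ T) := by
  ext y
  have hlaw : (μ.map T).map (fun a => (Y a, X a)) = μ.map fun a => ((Y ∘ T) a, (X ∘ T) a) :=
    Measure.map_map (hY.prodMk hX) hT
  simp only [condMean, condDistrib, hlaw]

variable {μ} {X : α → ℝ} {Y : α → β}

theorem condMean_comp_ae_eq_condExp (hX : Integrable X μ) (hY : Measurable Y) :
    condMean μ X Y ∘ Y =ᵐ[μ] μ[X | MeasurableSpace.comap Y inferInstance] :=
  (condExp_ae_eq_integral_condDistrib' hY hX).symm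

theorem integrable_condMean_comp (hX : Integrable X μ) (hY : Measurable Y) :
    Integrable (condMean μ X Y ∘ Y) μ :=
  integrable_condExp.congr (condMean_comp_ae_eq_condExp hX hY).symm

theorem setIntegral_condMean_comp (hX : Integrable X μ) (hY : Measurable Y) {A : Set β}
    (hA : MeasurableSet A) :
    ∫ a in Y ⁻¹' A, condMean μ X Y (Y a) ∂μ = ∫ a in Y ⁻¹' A, X a ∂μ := by
  rw [← setIntegral_condExp hY.comap_le hX ⟨A, hA, rfl⟩]
  exact setIntegral_congr_ae (hY hA)
    ((condMean_comp_ae_eq_condExp hX hY).mono fun _ ha _ => ha)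

theorem condMean_sum_mul_ae_eq {ι : Type*} [Fintype ι] (r : ι → ℝ) {X : ι → α → ℝ}
    (hX : ∀ k, Integrable (X k) μ) (hY : Measurable Y) :
    ∀ᵐ y ∂μ.map Y, condMean μ (∑ k, r k • X k) Y y = ∑ k, r k * condMean μ (X k) Y y := by
  have hrX (k : ι) : Integrable (r k • X k) μ := (hX k).smul (r k)
  refine (ae_map_iff hY.aemeasurable (measurableSet_eq_fun
    (stronglyMeasurable_condMean μ _ Y).measurable (Finset.measurable_fun_sum _ fun k _ =>
      (stronglyMeasurable_condMean μ (X k) Y).measurable.const_mul (r k)))).mpr ?_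
  filter_upwards [
    condMean_comp_ae_eq_condExp (integrable_finsetSum' Finset.univ fun k _ => hrX k) hY,
    condExp_finsetSum (fun k _ => hrX k) (MeasurableSpace.comap Y inferInstance),
    ae_all_iff.mpr fun k => condExp_smul (μ := μ) (r k) (X k)
      (MeasurableSpace.comap Y inferInstance),
    ae_all_iff.mpr fun k => condMean_comp_ae_eq_condExp (hX k) hY] with a hcond hsum hsmul hk
  rw [Function.comp_apply] at hcond
  rw [hcond, hsum, Finset.sum_apply]
  refine Finset.sum_congr rfl fun k _ => ?_
  rw [hsmul, Pi.smul_apply, ← hk, smul_eq_mul, Function.comp_apply]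

end

section

variable {P M : ℕ} (ω : Matrix (Fin P) (Fin M) ℝ) {V : Matrix (Fin P) (Fin P) ℝ}

theorem integrable_gaussianMatrix_apply (i : Fin P) (j : Fin M) :
    Integrable (fun ζ : Matrix (Fin P) (Fin M) ℝ => ζ i j) (gaussianMatrix P M) := by
  have hrow : Integrable (fun v : Fin M → ℝ => v j)
      (Measure.pi fun _ : Fin M => gaussianReal 0 1) :=
    integrable_comp_eval (f := id) (μ := fun _ : Fin M => gaussianReal 0 1)
      ((memLp_id_gaussianReal 1).integrable le_rfl)
  exact integrable_comp_eval (X := fun _ : Fin P => Fin M → ℝ)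
    (μ := fun _ : Fin P => Measure.pi fun _ : Fin M => gaussianReal 0 1) (i := i) hrow

theorem integrable_inv_mul_channelInput_sub_apply (hV : V.PosDef) (l : Fin P) (m : Fin M) :
    Integrable (fun ζ => (V⁻¹ * (channelInput ω V ζ - ω)) l m) (gaussianMatrix P M) := by
  simp only [inv_mul_channelInput_sub ω hV]
  simp only [Matrix.mul_apply]
  exact integrable_finsetSum _ fun k _ => (integrable_gaussianMatrix_apply k m).const_mul _

theorem posteriorMean_ae_eq_sqrt_mul_outputFilter (hV : V.PosDef) {K : ℕ}
    {g : Matrix (Fin P) (Fin M) ℝ → Matrix (Fin K) (Fin K) ℝ} (hg : Measurable g) :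
    ∀ᵐ y ∂(gaussianMatrix P M).map (channel g ω V),
      posteriorMean g y ω V = CFC.sqrt V * outputFilter g y ω V := by
  have hY : Measurable (channel g ω V) := hg.comp (continuous_channelInput ω V).measurable
  have hlin (l : Fin P) (m : Fin M) := condMean_sum_mul_ae_eq (CFC.sqrt V l)
    (fun k => integrable_inv_mul_channelInput_sub_apply ω hV k m) hY
  filter_upwards [ae_all_iff.mpr fun l => ae_all_iff.mpr (hlin l)] with y hy
  ext l m
  have hentry : (fun ζ : Matrix (Fin P) (Fin M) ℝ => ζ l m) =
      ∑ k, CFC.sqrt V l k • fun ζ => (V⁻¹ * (channelInput ω V ζ - ω)) k m := by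
    ext ζ
    simp only [Finset.sum_apply, Pi.smul_apply, smul_eq_mul, ← Matrix.mul_apply,
      inv_mul_channelInput_sub ω hV, mul_nonsing_inv_cancel_left _ _ (isUnit_det_sqrt hV)]
  rw [posteriorMean, Matrix.of_apply, hentry, hy, Matrix.mul_apply]
  rfl

end

/-! ### Conditioning on an even function -/

/-- The integral of `F` over the two fibres of `Prod.snd` above `w` and `-w`. -/
noncomputable def signedFiberIntegral {α E : Type*} [MeasurableSpace α] [Neg E] (ν : Measure α)
    (F : α × E → ℝ) (w : E) : ℝ :=
  (∫ z, F (z, w) ∂ν) + ∫ z, F (z, -w) ∂ν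

section

variable {α E β : Type*} [MeasurableSpace α] [InvolutiveNeg E] {ν : Measure α} {F : α × E → ℝ}

theorem signedFiberIntegral_eq_of_eq_or_eq_neg {v w : E} (h : v = w ∨ v = -w) :
    signedFiberIntegral ν F v = signedFiberIntegral ν F w := by
  rcases h with rfl | rfl
  · rfl
  · rw [signedFiberIntegral, neg_neg, add_comm, signedFiberIntegral]

theorem signedFiberIntegral_mul_even {h : E → ℝ} (hh : ∀ w, h (-w) = h w) (w : E) :
    signedFiberIntegral ν (fun p => F p * h p.2) w = signedFiberIntegral ν F w * h w := by
  simp only [signedFiberIntegral, integral_mul_const, hh, add_mul]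

variable [MeasurableSpace E] [MeasurableSpace β] [MeasurableNeg E]
  {η : Measure E} [η.IsNegInvariant] {S : E → β} {γ : β → E}

theorem ae_map_and_neg {p : E → Prop} (hp : MeasurableSet {w | p w}) (hS : Measurable S)
    (hγ : Measurable γ) (hγS : ∀ᵐ w ∂η, γ (S w) = w ∨ γ (S w) = -w) (h : ∀ᵐ w ∂η, p w) :
    ∀ᵐ y ∂η.map S, p (γ y) ∧ p (-γ y) := by
  refine (ae_map_iff hS.aemeasurable ((hγ hp).inter (hγ.neg hp))).mpr ?_
  filter_upwards [hγS, h, (Measure.measurePreserving_neg η).quasiMeasurePreserving.ae h]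
    with w hw hp_pos hp_neg
  change p (γ (S w)) ∧ p (-γ (S w))
  rcases hw with hw | hw <;> rw [hw]
  · exact ⟨hp_pos, hp_neg⟩
  · exact ⟨hp_neg, (neg_neg w).symm ▸ hp_pos⟩

variable [SFinite ν]

theorem stronglyMeasurable_signedFiberIntegral (hF : Measurable F) :
    StronglyMeasurable (signedFiberIntegral ν F) := by
  have hfiber : StronglyMeasurable fun w => ∫ z, F (z, w) ∂ν :=
    hF.stronglyMeasurable.integral_prod_left'
  exact hfiber.add (hfiber.comp_measurable measurable_neg)

variable [SFinite η]

theorem integrable_signedFiberIntegral (hF : Integrable F (ν.prod η)) :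
    Integrable (signedFiberIntegral ν F) η :=
  hF.integral_prod_right.add
    ((Measure.measurePreserving_neg η).integrable_comp_of_integrable hF.integral_prod_right)

theorem setIntegral_signedFiberIntegral (hF : Integrable F (ν.prod η)) {B : Set E}
    (hB_neg : Neg.neg ⁻¹' B = B) :
    ∫ w in B, signedFiberIntegral ν F w ∂η = 2 * ∫ p in Prod.snd ⁻¹' B, F p ∂(ν.prod η) := by
  have hfiber : Integrable (fun w => ∫ z, F (z, w) ∂ν) η := hF.integral_prod_right
  have hneg := Measure.measurePreserving_neg η
  have hfiber_neg : Integrable (fun w => ∫ z, F (z, -w) ∂ν) η :=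
    hneg.integrable_comp_of_integrable hfiber
  have hreflect : ∫ w in B, ∫ z, F (z, -w) ∂ν ∂η = ∫ w in B, ∫ z, F (z, w) ∂ν ∂η := by
    have h := hneg.setIntegral_preimage_emb (MeasurableEquiv.neg E).measurableEmbedding
      (fun w => ∫ z, F (z, w) ∂ν) B
    rwa [hB_neg] at h
  have hrestrict : (ν.prod η).restrict (Prod.snd ⁻¹' B) = ν.prod (η.restrict B) := by
    rw [← Set.univ_prod, ← Measure.prod_restrict, Measure.restrict_univ]
  have hF' : Integrable F (ν.prod (η.restrict B)) := hrestrict ▸ hF.integrableOn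
  simp only [signedFiberIntegral]
  rw [integral_add hfiber.integrableOn hfiber_neg.integrableOn, hreflect, ← two_mul, hrestrict,
    integral_prod_symm F hF']

theorem integrable_map_of_comp_ae_eq_signedFiberIntegral (hS : Measurable S)
    (hF : Integrable F (ν.prod η)) {N : β → ℝ} (hN : StronglyMeasurable N)
    (hNS : N ∘ S =ᵐ[η] signedFiberIntegral ν F) : Integrable N (η.map S) :=
  (integrable_map_measure hN.aestronglyMeasurable hS.aemeasurable).mpr
    ((integrable_signedFiberIntegral hF).congr hNS.symm)

theorem setIntegral_map_of_comp_ae_eq_signedFiberIntegral (hS : Measurable S)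
    (hS_neg : ∀ w, S (-w) = S w) (hF : Integrable F (ν.prod η)) {N : β → ℝ}
    (hN : StronglyMeasurable N) (hNS : N ∘ S =ᵐ[η] signedFiberIntegral ν F) {A : Set β}
    (hA : MeasurableSet A) :
    ∫ y in A, N y ∂η.map S = 2 * ∫ p in (S ∘ Prod.snd) ⁻¹' A, F p ∂(ν.prod η) := by
  have hSA : Neg.neg ⁻¹' (S ⁻¹' A) = S ⁻¹' A := by
    ext w
    simp only [Set.mem_preimage, hS_neg]
  have hcongr : ∫ w in S ⁻¹' A, N (S w) ∂η = ∫ w in S ⁻¹' A, signedFiberIntegral ν F w ∂η :=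
    setIntegral_congr_ae (hS hA) (hNS.mono fun _ hw _ => hw)
  rw [setIntegral_map hA hN.aestronglyMeasurable hS.aemeasurable, hcongr,
    setIntegral_signedFiberIntegral hF hSA, Set.preimage_comp]

theorem ae_map_integrable_and_neg (hF : Measurable F) (hFint : Integrable F (ν.prod η))
    (hS : Measurable S) (hγ : Measurable γ) (hγS : ∀ᵐ w ∂η, γ (S w) = w ∨ γ (S w) = -w) :
    ∀ᵐ y ∂η.map S,
      Integrable (fun z => F (z, γ y)) ν ∧ Integrable (fun z => F (z, -γ y)) ν :=
  ae_map_and_neg (p := fun w => Integrable (fun z => F (z, w)) ν)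
    (measurableSet_integrable (f := fun w z => F (z, w))
      (hF.comp measurable_swap).stronglyMeasurable) hS hγ hγS hFint.prod_left_ae

theorem condMean_mul_signedFiberIntegral_ae_eq {P : Measure (α × E)} [IsFiniteMeasure P]
    {ρ : α × E → ℝ} (hP : HasDensityPropTo P (ν.prod η) ρ) (hρ : Measurable ρ)
    (hρ0 : ∀ p, 0 ≤ ρ p) (hS : Measurable S) (hS_neg : ∀ w, S (-w) = S w) (hγ : Measurable γ)
    (hγS : ∀ᵐ w ∂η, γ (S w) = w ∨ γ (S w) = -w) {x : α × E → ℝ} (hx : Measurable x)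
    (hxP : Integrable x P) :
    ∀ᵐ y ∂η.map S, condMean P x (S ∘ Prod.snd) y * signedFiberIntegral ν ρ (γ y) =
      signedFiberIntegral ν (fun p => ρ p * x p) (γ y) := by
  have hY : Measurable (S ∘ Prod.snd : α × E → β) := hS.comp measurable_snd
  let m : β → ℝ := condMean P x (S ∘ Prod.snd)
  have hm : StronglyMeasurable m := stronglyMeasurable_condMean P x _
  have hρm : Integrable (fun p => ρ p * m (S p.2)) (ν.prod η) :=
    (hP.integrable_iff hρ hρ0).mp (integrable_condMean_comp hxP hY)
  have hρx : Integrable (fun p => ρ p * x p) (ν.prod η) := (hP.integrable_iff hρ hρ0).mp hxP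
  have hleft : (fun y => m y * signedFiberIntegral ν ρ (γ y)) ∘ S =ᵐ[η]
      signedFiberIntegral ν fun p => ρ p * m (S p.2) := by
    filter_upwards [hγS] with w hw
    have hpull := signedFiberIntegral_mul_even (ν := ν) (F := ρ) (h := m ∘ S)
      (fun w => congrArg m (hS_neg w)) w
    rw [Function.comp_apply, signedFiberIntegral_eq_of_eq_or_eq_neg hw]
    exact (mul_comm _ _).trans hpull.symm
  have hright : (fun y => signedFiberIntegral ν (fun p => ρ p * x p) (γ y)) ∘ S =ᵐ[η]
      signedFiberIntegral ν fun p => ρ p * x p :=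
    hγS.mono fun w hw => signedFiberIntegral_eq_of_eq_or_eq_neg (ν := ν)
      (F := fun p => ρ p * x p) hw
  have hleft_meas : StronglyMeasurable fun y => m y * signedFiberIntegral ν ρ (γ y) :=
    hm.mul ((stronglyMeasurable_signedFiberIntegral hρ).comp_measurable hγ)
  have hright_meas : StronglyMeasurable fun y =>
      signedFiberIntegral ν (fun p => ρ p * x p) (γ y) :=
    (stronglyMeasurable_signedFiberIntegral (hρ.mul hx)).comp_measurable hγ
  refine Integrable.ae_eq_of_forall_setIntegral_eq _ _
    (integrable_map_of_comp_ae_eq_signedFiberIntegral hS hρm hleft_meas hleft)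
    (integrable_map_of_comp_ae_eq_signedFiberIntegral hS hρx hright_meas hright)
    fun A hA _ => ?_
  rw [setIntegral_map_of_comp_ae_eq_signedFiberIntegral hS hS_neg hρm hleft_meas hleft hA,
    setIntegral_map_of_comp_ae_eq_signedFiberIntegral hS hS_neg hρx hright_meas hright hA]
  exact congrArg (2 * ·) ((hP.setIntegral_eq_iff hρ hρ0 (hY hA)).mp
    (setIntegral_condMean_comp hxP hY hA))

end

/-! ### The output filter -/

/-- The score `[V⁻¹ (H - ω)]_{lm}` as a function of the pair `(Z₁, Z₂ B_c¹(Z₁))`. -/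
noncomputable def mixedScore (c : ℝ) (ω V : Matrix (Fin 2) (Fin 2) ℝ) (l m : Fin 2)
    (p : (Fin 2 → ℝ) × (Fin 2 → ℝ)) : ℝ :=
  (V⁻¹ * (unmixIndices c p - ω)) l m

theorem measurable_mixedScore (c : ℝ) (ω V : Matrix (Fin 2) (Fin 2) ℝ) (l m : Fin 2) :
    Measurable (mixedScore c ω V l m) := by
  have hscore : Continuous fun X : Matrix (Fin 2) (Fin 2) ℝ => (V⁻¹ * (X - ω)) l m :=
    Continuous.matrix_elem (by fun_prop) l m
  exact hscore.measurable.comp (measurable_unmixIndices c)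

theorem denIntegrand_eq (c : ℝ) (y ω V : Matrix (Fin 2) (Fin 2) ℝ) (s : ℝ) :
    denIntegrand c y ω V s = fun z => mixedDensity c ω V (z, s • rankOneAttentionInv y) :=
  rfl

theorem filterDen_eq (c : ℝ) (y ω V : Matrix (Fin 2) (Fin 2) ℝ) :
    filterDen c y ω V =
      signedFiberIntegral volume (mixedDensity c ω V) (rankOneAttentionInv y) := by
  rw [filterDen, Finset.sum_pair (by norm_num : (1 : ℝ) ≠ -1)]
  simp only [denIntegrand_eq, one_smul, neg_smul, signedFiberIntegral]

section

variable {c : ℝ} (ω : Matrix (Fin 2) (Fin 2) ℝ) {V : Matrix (Fin 2) (Fin 2) ℝ}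

theorem numIntegrand_eq (c : ℝ) (y : Matrix (Fin 2) (Fin 2) ℝ) (hV : V.PosDef) (l m : Fin 2)
    (s : ℝ) :
    numIntegrand c y ω V l m s = fun z => mixedDensity c ω V (z, s • rankOneAttentionInv y) *
      mixedScore c ω V l m (z, s • rankOneAttentionInv y) := by
  ext z
  have hscore : ∑ l', (unmixIndices c (z, s • rankOneAttentionInv y) l' m - ω l' m) * V⁻¹ l' l =
      mixedScore c ω V l m (z, s • rankOneAttentionInv y) := by
    rw [mixedScore, Matrix.mul_apply]
    exact Finset.sum_congr rfl fun l' _ =>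
      (mul_comm _ _).trans (congrArg (· * _) (hV.inv.isHermitian.apply l l'))
  rw [← hscore, mixedDensity, div_mul_eq_mul_div]
  rfl

theorem filterNum_eq (c : ℝ) (y : Matrix (Fin 2) (Fin 2) ℝ) (hV : V.PosDef) (l m : Fin 2) :
    filterNum c y ω V l m = signedFiberIntegral volume
      (fun p => mixedDensity c ω V p * mixedScore c ω V l m p) (rankOneAttentionInv y) := by
  rw [filterNum, Finset.sum_pair (by norm_num : (1 : ℝ) ≠ -1)]
  simp only [numIntegrand_eq ω c y hV, one_smul, neg_smul, signedFiberIntegral]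

theorem channel_toyLink_eq (c : ℝ) (V : Matrix (Fin 2) (Fin 2) ℝ) :
    channel (toyLink c) ω V =
      (rankOneAttention ∘ Prod.snd) ∘ (mixIndices c ∘ channelInput ω V) :=
  funext fun _ => toyLink_eq c _

theorem measurable_mixIndices_channelInput (c : ℝ) (V : Matrix (Fin 2) (Fin 2) ℝ) :
    Measurable (mixIndices c ∘ channelInput ω V) :=
  ((continuous_mixIndices c).comp (continuous_channelInput ω V)).measurable

theorem map_channel_toyLink_absolutelyContinuous (hc : c ≠ -1) (hV : V.PosDef) :
    (gaussianMatrix 2 2).map (channel (toyLink c) ω V) ≪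
      (volume : Measure (Fin 2 → ℝ)).map rankOneAttention := by
  have hS : Measurable (rankOneAttention (M := 2)) := continuous_rankOneAttention.measurable
  rw [channel_toyLink_eq, ← Measure.map_map (hS.comp measurable_snd)
    (measurable_mixIndices_channelInput ω c V), ← Measure.map_map hS measurable_snd]
  exact ((((hasDensityPropTo_map_mixIndices_channelInput hc ω hV).absolutelyContinuous).map
    measurable_snd).trans Measure.quasiMeasurePreserving_snd.absolutelyContinuous).map hS

theorem ae_channel_toyLink_mem (hc : c ≠ -1) (hV : V.PosDef) :
    ∀ᵐ y ∂(gaussianMatrix 2 2).map (channel (toyLink c) ω V),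
      y 0 1 ∈ Set.Ioo 0 1 ∧ y 1 0 ∈ Set.Ioo 0 1 ∧ 0 < gammaLog (y 0 1) (y 1 0) := by
  have hentry (i j : Fin 2) : Measurable fun y : Matrix (Fin 2) (Fin 2) ℝ => y i j :=
    (continuous_id.matrix_elem i j).measurable
  have hset : MeasurableSet {y : Matrix (Fin 2) (Fin 2) ℝ |
      y 0 1 ∈ Set.Ioo 0 1 ∧ y 1 0 ∈ Set.Ioo 0 1 ∧ 0 < gammaLog (y 0 1) (y 1 0)} :=
    (hentry 0 1 measurableSet_Ioo).inter
      ((hentry 1 0 measurableSet_Ioo).inter (measurable_gammaLog measurableSet_Ioi))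
  refine (map_channel_toyLink_absolutelyContinuous ω hc hV).ae_le
    ((ae_map_iff continuous_rankOneAttention.measurable.aemeasurable hset).mpr ?_)
  filter_upwards [ae_apply_zero_ne_apply_one] with w hw
  rw [gammaLog_rankOneAttention, rankOneAttention_zero_one, rankOneAttention_one_zero]
  exact ⟨⟨Real.sigmoid_pos _, Real.sigmoid_lt_one _⟩, ⟨Real.sigmoid_pos _, Real.sigmoid_lt_one _⟩,
    sq_pos_of_ne_zero (sub_ne_zero.mpr hw.symm)⟩

theorem ae_integrable_mixedDensity_mul (hc : c ≠ -1) (hV : V.PosDef)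
    {x : (Fin 2 → ℝ) × (Fin 2 → ℝ) → ℝ} (hx : Measurable x)
    (hxP : Integrable x ((gaussianMatrix 2 2).map (mixIndices c ∘ channelInput ω V))) :
    ∀ᵐ y ∂(gaussianMatrix 2 2).map (channel (toyLink c) ω V), ∀ s ∈ ({1, -1} : Finset ℝ),
      Integrable fun z => mixedDensity c ω V (z, s • rankOneAttentionInv y) *
        x (z, s • rankOneAttentionInv y) := by
  have hdensity := hasDensityPropTo_map_mixIndices_channelInput hc ω hV
  simp only [Finset.mem_insert, Finset.mem_singleton, forall_eq_or_imp, forall_eq, one_smul,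
    neg_smul]
  exact (map_channel_toyLink_absolutelyContinuous ω hc hV).ae_le
    (ae_map_integrable_and_neg ((measurable_mixedDensity c ω V).mul hx)
      ((hdensity.integrable_iff (measurable_mixedDensity c ω V)
        (mixedDensity_nonneg c ω V)).mp hxP)
      continuous_rankOneAttention.measurable measurable_rankOneAttentionInv
      ae_rankOneAttentionInv_rankOneAttention)

theorem ae_integrable_denIntegrand (hc : c ≠ -1) (hV : V.PosDef) :
    ∀ᵐ y ∂(gaussianMatrix 2 2).map (channel (toyLink c) ω V), ∀ s ∈ ({1, -1} : Finset ℝ),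
      Integrable (denIntegrand c y ω V s) := by
  simpa only [mul_one, ← denIntegrand_eq] using ae_integrable_mixedDensity_mul ω hc hV
    measurable_const (integrable_const 1)

theorem integral_mixedDensity_pos (hc : c ≠ -1) (V : Matrix (Fin 2) (Fin 2) ℝ) {w : Fin 2 → ℝ}
    (h : Integrable fun z => mixedDensity c ω V (z, w)) :
    0 < ∫ z, mixedDensity c ω V (z, w) := by
  have hsupport : ∀ᵐ z : Fin 2 → ℝ, mixedDensity c ω V (z, w) ≠ 0 :=
    (ae_det_mixOne_ne_zero hc).mono fun z hz =>
      div_ne_zero (Real.exp_ne_zero _) (abs_ne_zero.mpr hz)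
  refine (integral_nonneg fun z => mixedDensity_nonneg c ω V _).lt_of_ne' fun hzero => ?_
  obtain ⟨z, hne, heq⟩ := (hsupport.and ((integral_eq_zero_iff_of_nonneg
    (fun z => mixedDensity_nonneg c ω V _) h).mp hzero)).exists
  exact hne heq

theorem ae_filterDen_pos (hc : c ≠ -1) (hV : V.PosDef) :
    ∀ᵐ y ∂(gaussianMatrix 2 2).map (channel (toyLink c) ω V), 0 < filterDen c y ω V := by
  filter_upwards [ae_integrable_denIntegrand ω hc hV] with y hy
  exact Finset.sum_pos (fun s hs => integral_mixedDensity_pos ω hc V (hy s hs))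
    (Finset.insert_nonempty _ _)

theorem mixedScore_mixIndices_channelInput_ae_eq (hc : c ≠ -1) (hV : V.PosDef) (l m : Fin 2) :
    mixedScore c ω V l m ∘ (mixIndices c ∘ channelInput ω V) =ᵐ[gaussianMatrix 2 2]
      fun ζ => (V⁻¹ * (channelInput ω V ζ - ω)) l m := by
  have hlaw := hasDensityPropTo_map_channelInput_gaussianMatrix (M := 2) ω hV
  filter_upwards [ae_of_ae_map (continuous_channelInput ω V).measurable.aemeasurable
    (hlaw.absolutelyContinuous.ae_le (ae_unmixIndices_mixIndices hc))] with ζ hζ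
  rw [Function.comp_apply, Function.comp_apply, mixedScore, hζ]

theorem integrable_mixedScore (hc : c ≠ -1) (hV : V.PosDef) (l m : Fin 2) :
    Integrable (mixedScore c ω V l m)
      ((gaussianMatrix 2 2).map (mixIndices c ∘ channelInput ω V)) :=
  (integrable_map_measure (measurable_mixedScore c ω V l m).aestronglyMeasurable
    (measurable_mixIndices_channelInput ω c V).aemeasurable).mpr
    ((integrable_inv_mul_channelInput_sub_apply ω hV l m).congr
      (mixedScore_mixIndices_channelInput_ae_eq ω hc hV l m).symm)

theorem ae_integrable_numIntegrand (hc : c ≠ -1) (hV : V.PosDef) :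
    ∀ᵐ y ∂(gaussianMatrix 2 2).map (channel (toyLink c) ω V), ∀ s ∈ ({1, -1} : Finset ℝ),
      ∀ l m, Integrable (numIntegrand c y ω V l m s) := by
  filter_upwards [ae_all_iff.mpr fun l => ae_all_iff.mpr fun m =>
    ae_integrable_mixedDensity_mul ω hc hV (measurable_mixedScore c ω V l m)
      (integrable_mixedScore ω hc hV l m)] with y hy s hs l m
  rw [numIntegrand_eq ω c y hV]
  exact hy l m s hs

theorem outputFilter_apply_eq_condMean_mixedScore (hc : c ≠ -1) (hV : V.PosDef)
    (y : Matrix (Fin 2) (Fin 2) ℝ) (l m : Fin 2) :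
    outputFilter (toyLink c) y ω V l m =
      condMean ((gaussianMatrix 2 2).map (mixIndices c ∘ channelInput ω V))
        (mixedScore c ω V l m) (rankOneAttention ∘ Prod.snd) y := by
  rw [condMean_map _ (measurable_mixIndices_channelInput ω c V) (measurable_mixedScore c ω V l m)
    (continuous_rankOneAttention.measurable.comp measurable_snd), ← channel_toyLink_eq,
    condMean_congr _ (mixedScore_mixIndices_channelInput_ae_eq ω hc hV l m)]
  rfl

theorem ae_outputFilter_toyLink_apply_eq (hc : c ≠ -1) (hV : V.PosDef) :
    ∀ᵐ y ∂(gaussianMatrix 2 2).map (channel (toyLink c) ω V), ∀ l m,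
      outputFilter (toyLink c) y ω V l m = filterNum c y ω V l m / filterDen c y ω V := by
  have hratio (l m : Fin 2) := (map_channel_toyLink_absolutelyContinuous ω hc hV).ae_le
    (condMean_mul_signedFiberIntegral_ae_eq
      (hasDensityPropTo_map_mixIndices_channelInput hc ω hV) (measurable_mixedDensity c ω V)
      (mixedDensity_nonneg c ω V) continuous_rankOneAttention.measurable rankOneAttention_neg
      measurable_rankOneAttentionInv ae_rankOneAttentionInv_rankOneAttention
      (measurable_mixedScore c ω V l m) (integrable_mixedScore ω hc hV l m))
  filter_upwards [ae_filterDen_pos ω hc hV, ae_all_iff.mpr fun l => ae_all_iff.mpr (hratio l)]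
    with y hpos hy l m
  rw [eq_div_iff hpos.ne', outputFilter_apply_eq_condMean_mixedScore ω hc hV, filterDen_eq,
    filterNum_eq ω c y hV]
  exact hy l m

end

theorem mainTheorem5 (c : ℝ) (hc : c ≠ -1) (ω V : Matrix (Fin 2) (Fin 2) ℝ) (hV : V.PosDef) :
    (∀ z w : Fin 2 → ℝ, z 0 ≠ z 1 →
      (softmax (Matrix.vecMulVec w w) = softmax (Matrix.vecMulVec z z) ↔
        w = gammaMap (softmax (Matrix.vecMulVec z z) 0 1) (softmax (Matrix.vecMulVec z z) 1 0) ∨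
        w = -gammaMap (softmax (Matrix.vecMulVec z z) 0 1)
          (softmax (Matrix.vecMulVec z z) 1 0))) ∧
    (∀ᵐ z₁ : Fin 2 → ℝ, (mixOne c z₁).det ≠ 0) ∧
    Measurable (channel (toyLink c) ω V) ∧
    ∀ᵐ y ∂((gaussianMatrix 2 2).map (channel (toyLink c) ω V)),
      y 0 1 ∈ Set.Ioo 0 1 ∧ y 1 0 ∈ Set.Ioo 0 1 ∧ 0 < gammaLog (y 0 1) (y 1 0) ∧
      (∀ s ∈ ({1, -1} : Finset ℝ), Integrable (denIntegrand c y ω V s)) ∧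
      (∀ s ∈ ({1, -1} : Finset ℝ), ∀ l m, Integrable (numIntegrand c y ω V l m s)) ∧
      0 < filterDen c y ω V ∧
      (∀ l m, outputFilter (toyLink c) y ω V l m = filterNum c y ω V l m / filterDen c y ω V) ∧
      posteriorMean (toyLink c) y ω V =
        CFC.sqrt V * Matrix.of fun l m => filterNum c y ω V l m / filterDen c y ω V := by
  refine ⟨fun z w hz => rankOneAttention_eq_iff hz w, ae_det_mixOne_ne_zero hc,
    ((continuous_toyLink c).comp (continuous_channelInput ω V)).measurable, ?_⟩
  filter_upwards [ae_channel_toyLink_mem ω hc hV, ae_integrable_denIntegrand ω hc hV,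
    ae_integrable_numIntegrand ω hc hV, ae_filterDen_pos ω hc hV,
    ae_outputFilter_toyLink_apply_eq ω hc hV,
    posteriorMean_ae_eq_sqrt_mul_outputFilter ω hV (continuous_toyLink c).measurable]
    with y ⟨h01, h10, hlog⟩ hden hnum hpos hout hpost
  exact ⟨h01, h10, hlog, hden, hnum, hpos, hout,
    hpost.trans (congrArg (CFC.sqrt V * ·) (Matrix.ext hout))⟩
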